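/- Let $m \ge n \ge 3$. The squares of the $m \times n$ projective checkerboard are the pairs $(p,q)$ of integers with $0 \le p \le m-1$ and $0 \le q \le n-1$. It is the digraph on these squares with an edge from each square $\sigma$ to $\sigma E$ and to $\sigma N$, where $(p,q)E = (p+1,q)$ if $p < m-1$ and $(m-1,q)E = (0,n-1-q)$, while $(p,q)N = (p,q+1)$ if $q < n-1$ and $(p,n-1)N = (m-1-p,0)$. Write $\sigma \sim \tau$ if $\{\sigma E,\sigma N\} \cap \{\tau E,\tau N\} \ne \emptyset$; the equivalence classes of the transitive closure of $\sim$ are called diagonals. With $S_i = \{(p,q) : p+q = i\}$, the diagonals are the sets $S_i \cup S_{m+n-3-i}$ for $0 \le i \le m+n-3$, together with $\{(m-1,n-1)\}$. The terminal diagonal of a hamiltonian path $\mathcal{H}$ is the diagonal containing its terminal square. If the terminal diagonal is $S_a \cup S_b$ with $a \le b$ and $a+b = m+n-3$, then a diagonal $S_i \cup S_j$ with $i \le j$ and $i+j = m+n-3$ is called inner if $i > a$. A diagonal travels east in $\mathcal{H}$ if, for each of its squares $\sigma$, the edge from $\sigma$ to $\sigma E$ is in $\mathcal{H}$. **Proposition.**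 Assume $m \ge n \ge 3$ and $1 \le p \le \lfloor (m+n)/2 \rfloor - 1$, and let $(x,y)$ be a square of the $m \times n$ projective checkerboard. There is a (directed) hamiltonian path $\mathcal{H}$ from $(p,0)$ to $(x,y)$ in which all inner diagonals travel east if and only if either 1. $x+y = p-1 \ge \lfloor (n-1)/2 \rfloor$ and $y = \lfloor (n-1)/2 \rfloor$, or 2. $x+y = m+n-p-2$, $y = \lfloor n/2 \rfloor$, and $\lfloor (n-1)/2 \rfloor \le p \le n-1$. -/

import Mathlib

namespace ProjectiveCheckerboard

/-- The squares `(p, q)` of an `m × n` checkerboard, `0 ≤ p ≤ m - 1` and `0 ≤ q ≤ n - 1`. -/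
abbrev Square (m n : ℕ) : Type := Fin m × Fin n

/-- The square reached by a step to the east; `Fin.rev q` is `n - 1 - q`. -/
def stepE {m n : ℕ} (σ : Square m n) : Square m n :=
  if h : (σ.1 : ℕ) < m - 1 then (⟨σ.1 + 1, by omega⟩, σ.2)
  else (⟨0, Nat.zero_lt_of_lt σ.1.isLt⟩, Fin.rev σ.2)

/-- The square reached by a step to the north; `Fin.rev p` is `m - 1 - p`. -/
def stepN {m n : ℕ} (σ : Square m n) : Square m n :=
  if h : (σ.2 : ℕ) < n - 1 then (σ.1, ⟨σ.2 + 1, by omega⟩)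
  else (Fin.rev σ.1, ⟨0, Nat.zero_lt_of_lt σ.2.isLt⟩)

/-- The `m × n` projective checkerboard, as a digraph. -/
def board (m n : ℕ) : Digraph (Square m n) where
  Adj σ ρ := ρ = stepE σ ∨ ρ = stepN σ

/-- `H` is the list of the squares, in order of visit, of a hamiltonian path from `ι` to `τ`. -/
structure IsHamiltonianPath {m n : ℕ} (H : List (Square m n)) (ι τ : Square m n) : Prop where
  chain : H.IsChain (board m n).Adj
  nodup : H.Nodup
  visits_all : ∀ σ : Square m n, σ ∈ H
  initial : H.head? = some ι
  terminal : H.getLast? = some τ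

/-- The edge from `σ` to `ρ` is in the path `H`. -/
def HasEdge {m n : ℕ} (H : List (Square m n)) (σ ρ : Square m n) : Prop :=
  [σ, ρ] <:+: H

/-- The square `σ` travels east in the path `H`. -/
def TravelsEast {m n : ℕ} (H : List (Square m n)) (σ : Square m n) : Prop :=
  HasEdge H σ (stepE σ)

/-- The relation `{σE, σN} ∩ {τE, τN} ≠ ∅`. -/
def Sim {m n : ℕ} (σ τ : Square m n) : Prop :=
  (({stepE σ, stepN σ} : Set (Square m n)) ∩ {stepE τ, stepN τ}).Nonempty

/-- The (direction-forcing) diagonal that contains `σ`: its equivalence class under the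
transitive closure of `Sim`. -/
def diagonal {m n : ℕ} (σ : Square m n) : Set (Square m n) :=
  {ρ | Relation.TransGen Sim σ ρ}

/-- The subdiagonal `S_i`. -/
def subdiagonal (m n i : ℕ) : Set (Square m n) :=
  {σ | (σ.1 : ℕ) + (σ.2 : ℕ) = i}

/-- `D` is an inner diagonal of a hamiltonian path with terminal square `τ`: the terminal diagonal
is `S_a ∪ S_b` with `a ≤ b` and `a + b = m + n - 3`, and `D` is a diagonal `S_i ∪ S_j` with `i ≤ j`
and `i + j = m + n - 3`, such that `i > a`. -/
def IsInnerDiagonal {m n : ℕ} (τ : Square m n) (D : Set (Square m n)) : Prop :=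
  (∃ σ, D = diagonal σ) ∧
    ∃ a b i j : ℕ, a ≤ b ∧ a + b + 3 = m + n ∧
      diagonal τ = subdiagonal m n a ∪ subdiagonal m n b ∧
      i ≤ j ∧ i + j + 3 = m + n ∧
      D = subdiagonal m n i ∪ subdiagonal m n j ∧
      a < i

end ProjectiveCheckerboard

namespace ProjectiveCheckerboard

/-! The initial square `(p, 0)` can be entered only from `(p-1, 0)` by an eastward step or from
`(m-1-p, n-1)` by a northward one. These lie on one diagonal, and a nonterminal diagonal travels in
a single direction, so it would use one of the two steps. Hence the terminal diagonal is `S_{p-1} ∪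
S_{m+n-p-2}` (`terminal_diagonal`), and its directions are forced by the position of the terminal
square.

A path that goes beyond `S_{m+n-p-2}` comes back at the square rotated by a half-turn (`rotation`),
so only the rows of the strip `p ≤ a+b ≤ m+n-p-2` matter. Let the terminal square be in row `y`. If
it is in the lower half, strip row `b` leads to row `n-1-b` when `n-1-b > y`, to row `n-b` when
`n-1-b < y`, and to the end when `n-1-b = y`. If it is in the upper half, row `b` leads to row
`n-1-b` when `b < y`, to row `n-b` when `b > y`, and row `y` leads to the end; rows that miss the
upper half wrap to row `n-1-b`, which is the source of the lower bound on `p`.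

Two rows exchanged by the same reflection form a cycle. Avoiding such pairs forces `y` to be central
(`necessity`). For central `y` the two reflections alternate, shifting rows one at a time towards
`y`, so every square reaches the end. `IsFlow` serves both directions: `T` is "visited earlier" for
necessity and "reaches the terminal square if the other does" for sufficiency. -/

/-- The relation `T` relates the square `(a, b)` to the square reached by a step to the east. -/
def EastStep (m n : ℕ) (T : ℕ → ℕ → ℕ → ℕ → Prop) (a b : ℕ) : Prop :=
  (a + 1 < m → T a b (a + 1) b) ∧ (a + 1 = m → T a b 0 (n - 1 - b))

/-- The relation `T` relates the square `(a, b)` to the square reached by a step to the north. -/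
def NorthStep (m n : ℕ) (T : ℕ → ℕ → ℕ → ℕ → Prop) (a b : ℕ) : Prop :=
  (b + 1 < n → T a b a (b + 1)) ∧ (b + 1 = n → T a b (m - 1 - a) 0)

theorem EastStep.wrap {m n : ℕ} {T : ℕ → ℕ → ℕ → ℕ → Prop} {a b d : ℕ}
    (h : EastStep m n T a b) (ha : a + 1 = m) (hd : d + b + 1 = n) : T a b 0 d := by
  obtain rfl : d = n - 1 - b := by omega
  exact h.2 ha

theorem NorthStep.wrap {m n : ℕ} {T : ℕ → ℕ → ℕ → ℕ → Prop} {a b c : ℕ}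
    (h : NorthStep m n T a b) (hb : b + 1 = n) (hc : c + a + 1 = m) : T a b c 0 := by
  obtain rfl : c = m - 1 - a := by omega
  exact h.2 hb

/-- A transitive relation between squares that contains the steps made inside the region between
the two halves of the terminal diagonal (all to the east), and that carries every square beyond
the upper half of the terminal diagonal to its image under the rotation by a half-turn. -/
structure IsFlow (m n p : ℕ) (T : ℕ → ℕ → ℕ → ℕ → Prop) : Prop where
  trans : ∀ {a b c d e f : ℕ}, T a b c d → T c d e f → T a b e f
  inner : ∀ a b, a < m → b < n → p ≤ a + b → a + b + p + 3 ≤ m + n → EastStep m n T a b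
  outer : ∀ a b c d, m + n ≤ a + b + p + 1 → a + c + 1 = m → b + d + 1 = n → T a b c d

/-! ### Motion from row to row of the strip -/

namespace IsFlow

variable {m n p : ℕ} {T : ℕ → ℕ → ℕ → ℕ → Prop}

/-- The condition `n ≤ p + b + 1` says that row `b` meets the upper half of the terminal diagonal
inside the board; `wrap` treats the complementary rows. -/
theorem to_upper (hF : IsFlow m n p T) {a b e : ℕ} (hb : b < n) (hpb : n ≤ p + b + 1)
    (hab : p ≤ a + b) (hae : a < e) (he : e + b + p + 2 = m + n) : T a b e b := by
  obtain ⟨k, rfl⟩ : ∃ k, e = a + 1 + k := ⟨e - a - 1, by omega⟩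
  induction k generalizing a with
  | zero => exact (hF.inner a b (by omega) hb hab (by omega)).1 (by omega)
  | succ k ih =>
    have h := ih (a := a + 1) (by omega) (by omega) (by omega)
    rw [show a + 1 + 1 + k = a + 1 + (k + 1) by omega] at h
    exact hF.trans ((hF.inner a b (by omega) hb hab (by omega)).1 (by omega)) h

theorem wrap (hF : IsFlow m n p T) {a b d : ℕ} (ha : a < m) (hpb : p + b + 2 ≤ n)
    (hab : p ≤ a + b) (hd : d + b + 1 = n) : T a b 0 d := by
  obtain ⟨k, hk⟩ : ∃ k, m = a + 1 + k := ⟨m - a - 1, by omega⟩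
  induction k generalizing a with
  | zero => exact (hF.inner a b ha (by omega) hab (by omega)).wrap (by omega) hd
  | succ k ih =>
    exact hF.trans ((hF.inner a b ha (by omega) hab (by omega)).1 (by omega))
      (ih (a := a + 1) (by omega) (by omega) (by omega))

theorem upper_east (hF : IsFlow m n p T) {a b c d : ℕ} (h : EastStep m n T a b)
    (hab : a + b + p + 2 = m + n) (hcd : c + d + 1 = p) (hd : d + b + 1 = n) : T a b c d :=
  hF.trans (h.1 (by omega)) (hF.outer _ _ _ _ (by omega) (by omega) (by omega))

section LowerTerminal

variable {y : ℕ} (hF : IsFlow m n p T)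
  (hU : ∀ a b, a < m → b < n → a + b + p + 2 = m + n → EastStep m n T a b)

include hF hU

theorem lower_row {a b c d : ℕ} (ha : a < m)
    (hab : p ≤ a + b) (hab' : a + b + p + 2 ≤ m + n)
    (hcd : c + d + 1 = p) (hd : d + b + 1 = n) : T a b c d := by
  have hend := hU (m + n - p - 2 - b) b (by omega) (by omega) (by omega)
  have h2 := hF.upper_east (c := c) (d := d) hend (by omega) hcd hd
  rcases Nat.lt_or_ge a (m + n - p - 2 - b) with h | h
  · exact hF.trans (hF.to_upper (by omega) (by omega) hab h (by omega)) h2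
  · obtain rfl : a = m + n - p - 2 - b := by omega
    exact h2

theorem lower_row_lt (hN : ∀ a b, a + b + 1 = p → b < y → T a b a (b + 1))
    {a b c d : ℕ} (ha : a < m) (hab : p ≤ a + b) (hab' : a + b + p + 2 ≤ m + n)
    (hd : d + b = n) (hdy : d ≤ y) (hcd : c + d = p) (hb : b < n) : T a b c d := by
  obtain ⟨e, rfl⟩ : ∃ e, d = e + 1 := ⟨d - 1, by omega⟩
  exact hF.trans (hF.lower_row hU (c := c) (d := e) ha hab hab' (by omega) (by omega))
    (hN _ _ (by omega) (by omega))

theorem lower_row_eq {a b x : ℕ} (hxy : x + y + 1 = p) (ha : a < m) (hab : p ≤ a + b)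
    (hab' : a + b + p + 2 ≤ m + n) (hd : y + b + 1 = n) : T a b x y :=
  hF.lower_row hU ha hab hab' hxy hd

theorem lower_row_gt (hpm : p < m)
    (hE : ∀ a b, a + b + 1 = p → b < n → y < b → EastStep m n T a b)
    {a b d : ℕ} (ha : a < m) (hab : p ≤ a + b) (hab' : a + b + p + 2 ≤ m + n)
    (hd : d + b + 1 = n) (hdy : y < d) : T a b (p - d) d := by
  rcases Nat.lt_or_ge d p with h | h
  · obtain ⟨c, hc⟩ : ∃ c, c + d + 1 = p := ⟨p - d - 1, by omega⟩
    have h2 := (hE c d hc (by omega) hdy).1 (by omega)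
    -- In the conclusion, `p - d` is the first column of row `d` in the strip; truncated subtraction
    -- makes it `0` for rows with `d ≥ p`, which are entered by wrapping.
    rw [show p - d = c + 1 by omega]
    exact hF.trans (hF.lower_row hU ha hab hab' hc hd) h2
  · rw [show p - d = 0 by omega]
    rcases h.eq_or_lt with rfl | h
    · have h2 := (hU (m - 1) b (by omega) (by omega) (by omega)).wrap (by omega) hd
      rcases Nat.lt_or_ge a (m - 1) with h | h
      · exact hF.trans (hF.to_upper (by omega) (by omega) hab h (by omega)) h2
      · obtain rfl : a = m - 1 := by omega
        exact h2
    · exact hF.wrap ha (by omega) hab hd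

end LowerTerminal

section UpperTerminal

variable {x y : ℕ} (hF : IsFlow m n p T)
  (hL : ∀ a b, a + b + 1 = p → T a b a (b + 1))

include hF

/-- The first alternative is needed because `T` may be a strict order, under which the terminal
square is not related to itself. -/
theorem upper_row_eq {a b : ℕ} (hab : p ≤ a + b) (hab' : a + b + p + 2 ≤ m + n) (hx : x < m)
    (hy : y < n) (hxy : x + y + p + 2 = m + n) (hb : b = y) :
    (a = x ∧ b = y) ∨ T a b x y := by
  subst hb
  rcases Nat.lt_or_ge a x with h | h
  · exact Or.inr (hF.to_upper hy (by omega) hab h hxy)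
  · exact Or.inl ⟨by omega, rfl⟩

include hL

theorem upper_row_lt (hN : ∀ a b, a < m → a + b + p + 2 = m + n → b < y → T a b a (b + 1))
    {a b c d : ℕ} (hyn : y < n) (hab : p ≤ a + b) (hab' : a + b + p + 2 ≤ m + n)
    (hb : b < y) (hcd : c + d = p) (hd : d + b + 1 = n) : T a b c d := by
  obtain ⟨d, rfl⟩ : ∃ e, d = e + 1 := ⟨d - 1, by omega⟩
  have h3 := hL c d (by omega)
  have h2 := hF.trans (hN (m + n - p - 2 - b) b (by omega) (by omega) hb)
    (hF.trans (hF.outer _ _ c d (by omega) (by omega) (by omega)) h3)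
  rcases Nat.lt_or_ge a (m + n - p - 2 - b) with h | h
  · exact hF.trans (hF.to_upper (by omega) (by omega) hab h (by omega)) h2
  · obtain rfl : a = m + n - p - 2 - b := by omega
    exact h2

theorem upper_row_gt (hE : ∀ a b, a < m → b < n → a + b + p + 2 = m + n → y < b →
      EastStep m n T a b)
    {a b c d : ℕ} (hy : n ≤ y + p + 1) (hab : p ≤ a + b) (hab' : a + b + p + 2 ≤ m + n)
    (hb : y < b) (hbn : b < n) (hcd : c + d = p) (hd : d + b = n) : T a b c d := by
  obtain ⟨d, rfl⟩ : ∃ e, d = e + 1 := ⟨d - 1, by omega⟩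
  have h2 := hF.trans (hF.upper_east (c := c) (d := d)
    (hE (m + n - p - 2 - b) b (by omega) (by omega) (by omega) hb)
    (by omega) (by omega) (by omega)) (hL _ _ (by omega))
  rcases Nat.lt_or_ge a (m + n - p - 2 - b) with h | h
  · exact hF.trans (hF.to_upper (by omega) (by omega) hab h (by omega)) h2
  · obtain rfl : a = m + n - p - 2 - b := by omega
    exact h2

end UpperTerminal

end IsFlow

/-! ### Propagation along a diagonal -/

section Across

variable {m n : ℕ} {Q : ℕ → ℕ → Prop}

theorem along_subdiagonal (h1 : ∀ a b, a + 1 < m → b + 1 < n → Q a (b + 1) → Q (a + 1) b)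
    {a b c d : ℕ} (h : a + b = c + d) (hac : a ≤ c) (hc : c < m) (hb : b < n) (hQ : Q a b) :
    Q c d := by
  obtain ⟨k, rfl⟩ : ∃ k, c = a + k := ⟨c - a, by omega⟩
  induction k generalizing d with
  | zero =>
    obtain rfl : b = d := by omega
    exact hQ
  | succ k ih =>
    exact h1 (a + k) d (by omega) (by omega)
      (ih (d := d + 1) (by omega) (by omega) (by omega))

/-- A property that passes from `σ` to `σEN⁻¹` passes from one half of a diagonal to the other. -/
theorem across_diagonal (h1 : ∀ a b, a + 1 < m → b + 1 < n → Q a (b + 1) → Q (a + 1) b)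
    (h2 : ∀ a c, a + c + 2 = m → Q a 0 → Q c (n - 1))
    (h3 : ∀ b d, b + d + 2 = n → Q (m - 1) b → Q 0 d)
    {a b c d : ℕ} (h : a + b + c + d + 3 = m + n) (ha : a < m) (hb : b < n) (hc : c < m)
    (hd : d < n) (hQ : Q a b) : Q c d := by
  -- The steps `σ ↦ σEN⁻¹` descend to the lowest square of the half, on the bottom row or the right
  -- column. The next one jumps to the highest square of the other half.
  rcases Nat.lt_or_ge (a + b + 1) m with hk | hk
  · refine along_subdiagonal h1 (a := m - 2 - (a + b)) (b := n - 1) (by omega) (by omega) hc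
      (by omega) (h2 (a + b) _ (by omega) ?_)
    exact along_subdiagonal h1 (by omega) (by omega) (by omega) hb hQ
  · refine along_subdiagonal h1 (a := 0) (b := c + d) (by omega) (by omega) hc
      (by omega) (h3 (a + b + 1 - m) _ (by omega) ?_)
    exact along_subdiagonal h1 (by omega) (by omega) (by omega) hb hQ

end Across

/-! ### Necessity: directions forced by injectivity -/

/-- The function `r` numbers the squares in the order in which they are visited by a hamiltonian
path from `(p, 0)` to `(x, y)`. -/
structure IsRank (m n p x y : ℕ) (r : ℕ → ℕ → ℕ) : Prop where
  inj : ∀ a b c d, a < m → b < n → c < m → d < n → r a b = r c d → a = c ∧ b = d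
  start : r p 0 = 0
  step : ∀ a b, a < m → b < n → (a = x ∧ b = y) ∨
    EastStep m n (fun a b c d => r c d = r a b + 1) a b ∨
    NorthStep m n (fun a b c d => r c d = r a b + 1) a b

/-- The square `(a, b)` is followed by its eastern neighbour in the order given by `r`. -/
abbrev GoesEast (m n : ℕ) (r : ℕ → ℕ → ℕ) (a b : ℕ) : Prop :=
  EastStep m n (fun a b c d => r c d = r a b + 1) a b

/-- The square `(a, b)` is followed by its northern neighbour in the order given by `r`. -/
abbrev GoesNorth (m n : ℕ) (r : ℕ → ℕ → ℕ) (a b : ℕ) : Prop :=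
  NorthStep m n (fun a b c d => r c d = r a b + 1) a b

theorem EastStep.mono {m n : ℕ} {T T' : ℕ → ℕ → ℕ → ℕ → Prop} {a b : ℕ}
    (h : EastStep m n T a b) (hT : ∀ a b c d, T a b c d → T' a b c d) : EastStep m n T' a b :=
  ⟨fun h' => hT _ _ _ _ (h.1 h'), fun h' => hT _ _ _ _ (h.2 h')⟩

namespace IsRank

variable {m n p x y : ℕ} {r : ℕ → ℕ → ℕ} (hr : IsRank m n p x y r) (hm : 3 ≤ m) (hn : 3 ≤ n)

include hr

include hm hn in
-- The corner `(m-1, n-1)` is excluded because both of its steps lead to `(0, 0)`.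
theorem not_both {a b : ℕ} (ha : a < m) (hb : b < n) (hab : a + b + 2 ≠ m + n)
    (hE : GoesEast m n r a b) (hN : GoesNorth m n r a b) : False := by
  rcases Nat.lt_or_ge (a + 1) m with h | h
  · have e1 := hE.1 h
    rcases Nat.lt_or_ge (b + 1) n with h' | h'
    · have e2 := hN.1 h'
      have := hr.inj (a + 1) b a (b + 1) (by omega) (by omega) (by omega) (by omega)
        (by simp only [e1, e2])
      omega
    · have e2 := hN.2 (by omega)
      have := hr.inj (a + 1) b (m - 1 - a) 0 (by omega) (by omega) (by omega) (by omega)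
        (by simp only [e1, e2])
      omega
  · have e1 := hE.2 (by omega)
    have e2 := hN.1 (by omega)
    have := hr.inj 0 (n - 1 - b) a (b + 1) (by omega) (by omega) (by omega) (by omega)
        (by simp only [e1, e2])
    omega

theorem east_next {a b : ℕ} (ha : a + 1 < m) (hb : b + 1 < n) (hE : GoesEast m n r a (b + 1))
    (hτ : ¬ (a + 1 = x ∧ b = y)) : GoesEast m n r (a + 1) b := by
  rcases hr.step (a + 1) b ha (by omega) with h | h | h
  · exact absurd h hτ
  · exact h
  · have e1 := hE.1 ha
    have e2 := h.1 hb
    have := hr.inj a (b + 1) (a + 1) b (by omega) (by omega) (by omega) (by omega)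
        (by simp only at e1 e2; omega)
    omega

include hn in
theorem east_next_bottom {a c : ℕ} (hac : a + c + 2 = m) (hE : GoesEast m n r a 0)
    (hτ : ¬ (c = x ∧ n - 1 = y)) : GoesEast m n r c (n - 1) := by
  rcases hr.step c (n - 1) (by omega) (by omega) with h | h | h
  · exact absurd h hτ
  · exact h
  · have e1 := hE.1 (by omega)
    have e2 := h.wrap (c := a + 1) (by omega) (by omega)
    have := hr.inj a 0 c (n - 1) (by omega) (by omega) (by omega) (by omega)
        (by simp only at e1 e2; omega)
    omega

include hm in
theorem east_next_right {b d : ℕ} (hbd : b + d + 2 = n) (hE : GoesEast m n r (m - 1) b)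
    (hτ : ¬ (0 = x ∧ d = y)) : GoesEast m n r 0 d := by
  rcases hr.step 0 d (by omega) (by omega) with h | h | h
  · exact absurd h hτ
  · exact h
  · have e1 := hE.wrap (d := d + 1) (by omega) (by omega)
    have e2 := h.1 (by omega)
    have := hr.inj (m - 1) b 0 d (by omega) (by omega) (by omega) (by omega)
        (by simp only at e1 e2; omega)
    omega

include hm hn in
/-- On a diagonal that is not terminal, eastward travel passes from one half to the other. -/
theorem east_across {a b c d : ℕ} (h : a + b + c + d + 3 = m + n) (ha : a < m) (hb : b < n)
    (hc : c < m) (hd : d < n) (h1 : x + y ≠ a + b) (h2 : x + y ≠ c + d)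
    (hE : GoesEast m n r a b) : GoesEast m n r c d := by
  refine (across_diagonal (m := m) (n := n)
    (Q := fun a' b' => (a' + b' = a + b ∨ a' + b' = c + d) ∧ GoesEast m n r a' b')
    ?_ ?_ ?_ h ha hb hc hd ⟨Or.inl rfl, hE⟩).2
  · rintro a' b' ha' hb' ⟨hl, hE'⟩
    exact ⟨by omega, hr.east_next ha' hb' hE' (by omega)⟩
  · rintro a' c' hac ⟨hl, hE'⟩
    exact ⟨by omega, hr.east_next_bottom hn hac hE' (by omega)⟩
  · rintro b' d' hbd ⟨hl, hE'⟩
    exact ⟨by omega, hr.east_next_right hm hbd hE' (by omega)⟩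

theorem not_east_before_start (hp : 1 ≤ p) (hpm : p < m) : ¬ GoesEast m n r (p - 1) 0 := by
  intro h
  have := h.1 (by omega)
  rw [show p - 1 + 1 = p by omega, hr.start] at this
  omega

include hn in
theorem not_north_before_start (hpm : p < m) : ¬ GoesNorth m n r (m - 1 - p) (n - 1) := by
  intro h
  have := h.wrap (c := p) (by omega) (by omega)
  simp only [hr.start] at this
  omega

include hm hn in
/-- The diagonal whose out-neighbours include the initial square is terminal. -/
theorem terminal_diagonal (hp : 1 ≤ p) (hpm : p < m) :
    x + y + 1 = p ∨ x + y + p + 2 = m + n := by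
  by_contra hcon
  have hE : GoesEast m n r (m - 1 - p) (n - 1) := by
    rcases hr.step (m - 1 - p) (n - 1) (by omega) (by omega) with h | h | h
    · omega
    · exact h
    · exact absurd h (hr.not_north_before_start hn hpm)
  exact hr.not_east_before_start hp hpm
    (hr.east_across hm hn (by omega) (by omega) (by omega) (by omega) (by omega) (by omega)
      (by omega) hE)

include hm hn in
/-- Whatever the directions of the outer diagonals, a path that enters the outer region at a square
leaves it at the image of that square under the rotation by a half-turn. -/
theorem rotation (hp : 1 ≤ p) (hp2 : 2 * p + 2 ≤ m + n)
    (hτ : x + y + 1 = p ∨ x + y + p + 2 = m + n) {a b c d : ℕ}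
    (hab : m + n ≤ a + b + p + 1) (hac : a + c + 1 = m) (hbd : b + d + 1 = n) :
    r a b < r c d := by
  obtain ⟨k, hk⟩ : ∃ k, c + d = k := ⟨_, rfl⟩
  -- Induction on the distance from `(a, b)` to the corner. The first step of `(a, b)` and the last
  -- step into `(c, d)` start on the same nonterminal diagonal, so they have the same direction, and
  -- the rotation by a half-turn matches their other ends.
  induction k generalizing a b c d with
  | zero =>
    obtain rfl : c = 0 := by omega
    obtain rfl : d = 0 := by omega
    rcases hr.step a b (by omega) (by omega) with h | h | h
    · omega
    · have := h.wrap (d := 0) (by omega) (by omega)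
      omega
    · have := h.wrap (c := 0) (by omega) (by omega)
      omega
  | succ k ih =>
    rcases hr.step a b (by omega) (by omega) with h | h | h
    · omega
    · rcases Nat.eq_zero_or_pos c with rfl | hc
      · have := h.wrap (d := d) (by omega) (by omega)
        omega
      · obtain ⟨c, rfl⟩ : ∃ e, c = e + 1 := ⟨c - 1, by omega⟩
        have h1 := h.1 (by omega)
        have h2 := ih (a := a + 1) (b := b) (c := c) (d := d) (by omega) (by omega) (by omega)
          (by omega)
        have h3 := (hr.east_across hm hn (c := c) (d := d) (by omega) (by omega) (by omega)
          (by omega) (by omega) (by omega) (by omega) h).1 (by omega)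
        simp only at h1 h3
        omega
    · rcases Nat.eq_zero_or_pos d with rfl | hd
      · have := h.wrap (c := c) (by omega) (by omega)
        omega
      · obtain ⟨d, rfl⟩ : ∃ e, d = e + 1 := ⟨d - 1, by omega⟩
        have h1 := h.1 (by omega)
        have h2 := ih (a := a) (b := b + 1) (c := c) (d := d) (by omega) (by omega) (by omega)
          (by omega)
        rcases hr.step c d (by omega) (by omega) with h' | h' | h'
        · omega
        · have h3 := hr.east_across hm hn (c := a) (d := b) (by omega) (by omega) (by omega)
            (by omega) (by omega) (by omega) (by omega) h'
          exact (hr.not_both hm hn (by omega) (by omega) (by omega) h3 h).elim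
        · have h3 := h'.1 (by omega)
          simp only at h1 h3
          omega

include hm hn in
theorem isFlow (hp : 1 ≤ p) (hp2 : 2 * p + 2 ≤ m + n)
    (hτ : x + y + 1 = p ∨ x + y + p + 2 = m + n)
    (hI : ∀ a b, a < m → b < n → p ≤ a + b → a + b + p + 3 ≤ m + n → GoesEast m n r a b) :
    IsFlow m n p (fun a b c d => r a b < r c d) where
  trans := fun h h' => h.trans h'
  inner := fun a b ha hb h h' => (hI a b ha hb h h').mono (fun _ _ _ _ h => by omega)
  outer := fun a b c d h h' h'' => hr.rotation hm hn hp hp2 hτ h h' h''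

/-- Eastward travel would propagate down the subdiagonal to `(p-1, 0)`, whose eastern neighbour is
the initial square; the hypothesis `hτ` keeps the terminal square off the way. -/
theorem lower_not_east (hp : 1 ≤ p) (hpm : p < m) {a b : ℕ} (hb : b < n) (hab : a + b + 1 = p)
    (hτ : x + y + 1 ≠ p ∨ b < y) : ¬ GoesEast m n r a b := by
  intro hE
  refine hr.not_east_before_start hp hpm
    (along_subdiagonal (m := m) (n := n) (Q := fun a' b' => a' + b' + 1 = p ∧
      (x + y + 1 ≠ p ∨ b' < y) ∧ GoesEast m n r a' b') ?_ (a := a) (b := b) (by omega)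
      (by omega) (by omega) hb ⟨hab, hτ, hE⟩).2.2
  rintro a' b' ha' hb' ⟨hl, hl', hE'⟩
  exact ⟨by omega, by omega, hr.east_next ha' hb' hE' (by omega)⟩

theorem lower_north (hp : 1 ≤ p) (hpm : p < m) {a b : ℕ} (hb : b < n) (hab : a + b + 1 = p)
    (hτ : x + y + 1 ≠ p ∨ b < y) : GoesNorth m n r a b := by
  rcases hr.step a b (by omega) hb with h | h | h
  · omega
  · exact absurd h (hr.lower_not_east hp hpm hb hab hτ)
  · exact h

include hn in
theorem upper_east (hpm : p < m) {a b : ℕ} (ha : a < m)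
    (hb : b < n) (hab : a + b + p + 2 = m + n) (hτ : x + y + p + 2 ≠ m + n ∨ y < b) :
    GoesEast m n r a b := by
  -- The propagation starts at `(m-1-p, n-1)`, which cannot go north into the initial square, and
  -- continues down until it meets row `y`.
  refine (along_subdiagonal (m := m) (n := n) (Q := fun a' b' => a' + b' + p + 2 = m + n ∧
    (x + y + p + 2 ≠ m + n ∨ y < b' → GoesEast m n r a' b')) ?_ (a := m - 1 - p) (b := n - 1)
      (by omega) (by omega) ha (by omega) ⟨by omega, fun h => ?_⟩).2 hτ
  · rintro a' b' ha' hb' ⟨hl, hE'⟩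
    exact ⟨by omega, fun h => hr.east_next ha' hb' (hE' (by omega)) (by omega)⟩
  · rcases hr.step (m - 1 - p) (n - 1) (by omega) (by omega) with h | h | h
    · omega
    · exact h
    · exact absurd h (hr.not_north_before_start hn hpm)

include hm hn in
theorem lower_east (hp : 1 ≤ p) (hpm : p < m) (hp2 : 2 * p + 2 ≤ m + n) {a b : ℕ}
    (hb : b < n) (hab : a + b + 1 = p) (hτ : x + y + 1 = p) (hby : y < b) :
    GoesEast m n r a b := by
  refine (across_diagonal (m := m) (n := n) (Q := fun a' b' =>
    (a' + b' + 1 = p ∨ a' + b' + p + 2 = m + n) ∧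
    (a' + b' + 1 = p → y < b' → GoesEast m n r a' b') ∧
      (a' + b' + 1 ≠ p → GoesEast m n r a' b')) ?_ ?_ ?_ (a := m - 1 - p) (b := n - 1)
      (by omega) (by omega) (by omega) (by omega) hb
      ⟨by omega, fun h => by omega, fun h => ?_⟩).2.1 hab hby
  · rintro a' b' ha' hb' ⟨hl, h1, h2⟩
    exact ⟨by omega, fun h h' => hr.east_next ha' hb' (h1 (by omega) (by omega)) (by omega),
      fun h => hr.east_next ha' hb' (h2 (by omega)) (by omega)⟩
  · rintro a' c' hac ⟨hl, h1, h2⟩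
    refine ⟨by omega, fun h h' => hr.east_next_bottom hn hac (h2 (by omega)) (by omega),
      fun h => hr.upper_east hn hpm (by omega) (by omega) (by omega) (by omega)⟩
  · rintro b' d' hbd ⟨hl, h1, h2⟩
    have : m - 1 + b' + 1 ≠ p := by omega
    exact ⟨by omega, fun h h' => hr.east_next_right hm hbd (h2 this) (by omega),
      fun h => hr.east_next_right hm hbd (h2 this) (by omega)⟩
  · exact hr.upper_east hn hpm (by omega) (by omega) (by omega) (by omega)

include hm in
-- Since `p < n`, the upper half ends on the right column. Eastward travel below row `y` would cross
-- from there to `(0, p-1)`, contradicting `lower_not_east`.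
theorem upper_north (hp : 1 ≤ p) (hpm : p < m) (hp2 : 2 * p + 2 ≤ m + n) (hpn : p < n) {a b : ℕ}
    (ha : a < m) (hb : b < n) (hab : a + b + p + 2 = m + n) (hτ : x + y + p + 2 = m + n)
    (hby : b < y) : GoesNorth m n r a b := by
  rcases hr.step a b ha hb with h | h | h
  · omega
  · exfalso
    have hE := (along_subdiagonal (m := m) (n := n) (Q := fun a' b' => a' + b' + p + 2 = m + n ∧
      b' < y ∧ GoesEast m n r a' b') (c := m - 1) (d := n - 1 - p) (fun a' b' ha' hb' h =>
        ⟨by omega, by omega, hr.east_next ha' hb' h.2.2 (by omega)⟩) (by omega) (by omega)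
        (by omega) hb ⟨hab, hby, h⟩).2.2
    have hE' := hr.east_next_right hm (d := p - 1) (by omega) hE (by omega)
    exact hr.lower_not_east hp hpm (by omega) (by omega) (by omega) hE'
  · exact h

include hm hn in
theorem necessity (hp : 1 ≤ p) (hpm : p < m) (hp2 : 2 * p + 2 ≤ m + n) (hx : x < m) (hy : y < n)
    (hI : x + y + 1 = p ∨ x + y + p + 2 = m + n → ∀ a b, a < m → b < n → p ≤ a + b →
      a + b + p + 3 ≤ m + n → GoesEast m n r a b) :
    (x + y + 1 = p ∧ y = (n - 1) / 2) ∨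
      (x + y + p + 2 = m + n ∧ y = n / 2 ∧ (n - 1) / 2 ≤ p ∧ p < n) := by
  have hτ := hr.terminal_diagonal hm hn hp hpm
  have hF := hr.isFlow hm hn hp hp2 hτ (hI hτ)
  rcases hτ with hτ | hτ
  · refine Or.inl ⟨hτ, ?_⟩
    have hU : ∀ a b, a < m → b < n → a + b + p + 2 = m + n →
        EastStep m n (fun a b c d => r a b < r c d) a b := fun a b ha hb hab =>
      (hr.upper_east hn hpm ha hb hab (by omega)).mono (fun _ _ _ _ h => by omega)
    have hN : ∀ a b, a + b + 1 = p → b < y → r a b < r a (b + 1) := fun a b hab hb => by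
      have := (hr.lower_north hp hpm (by omega) hab (by omega)).1 (by omega)
      simp only at this
      omega
    have hE : ∀ a b, a + b + 1 = p → b < n → y < b →
        EastStep m n (fun a b c d => r a b < r c d) a b := fun a b hab hb hby =>
      (hr.lower_east hm hn hp hpm hp2 hb hab hτ hby).mono (fun _ _ _ _ h => by omega)
    by_contra hcon
    rcases Nat.lt_or_ge (2 * y) n with h | h
    · have h1 := hF.lower_row_gt hU hpm hE (a := p - (y + 1)) (b := y + 1) (d := n - 2 - y)
        (by omega) (by omega) (by omega) (by omega) (by omega)
      have h2 := hF.lower_row_gt hU hpm hE (a := p - (n - 2 - y)) (b := n - 2 - y) (d := y + 1)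
        (by omega) (by omega) (by omega) (by omega) (by omega)
      exact lt_asymm h1 h2
    -- Above the centre, rows `y` and `n - y` lead to each other.
    · have h1 := hF.lower_row_lt hU hN (a := p - y) (b := y) (d := n - y) (c := p - (n - y))
        (by omega) (by omega) (by omega) (by omega) (by omega) (by omega) (by omega)
      have h2 := hF.lower_row_lt hU hN (a := p - (n - y)) (b := n - y) (d := y) (c := p - y)
        (by omega) (by omega) (by omega) (by omega) (by omega) (by omega) (by omega)
      exact lt_asymm h1 h2
  · refine Or.inr ⟨hτ, ?_⟩
    have hpn : p < n := by
      by_contra hcon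
      -- If `n ≤ p`, then `(p-n, n-1)` goes north to its own image under the half-turn, which leads
      -- back to it.
      have h1 := (hr.lower_north hp hpm (a := p - n) (b := n - 1) (by omega) (by omega)
        (by omega)).wrap (c := m + n - p - 1) (by omega) (by omega)
      have h2 := hF.outer (m + n - p - 1) 0 (p - n) (n - 1) (by omega) (by omega) (by omega)
      omega
    have hL : ∀ a b, a + b + 1 = p → r a b < r a (b + 1) := fun a b hab => by
      have := (hr.lower_north hp hpm (by omega) hab (by omega)).1 (by omega)
      simp only at this
      omega
    have hN : ∀ a b, a < m → a + b + p + 2 = m + n → b < y → r a b < r a (b + 1) :=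
      fun a b ha hab hb => by
        have := (hr.upper_north hm hp hpm hp2 hpn ha (by omega) hab hτ hb).1 (by omega)
        simp only at this
        omega
    have hE : ∀ a b, a < m → b < n → a + b + p + 2 = m + n → y < b →
        EastStep m n (fun a b c d => r a b < r c d) a b := fun a b ha hb hab hby =>
      (hr.upper_east hn hpm ha hb hab (by omega)).mono (fun _ _ _ _ h => by omega)
    have hpn2 : n ≤ 2 * p + 2 := by
      by_contra hcon
      -- For small `p`, rows `p + 1` and `n - p - 2` wrap into each other without meeting the
      -- terminal diagonal.
      have h1 := hF.wrap (a := 0) (b := p + 1) (d := n - p - 2) (by omega) (by omega) (by omega)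
        (by omega)
      have h2 := hF.wrap (a := 0) (b := n - p - 2) (d := p + 1) (by omega) (by omega) (by omega)
        (by omega)
      exact lt_asymm h1 h2
    -- If `y` is too large, rows `y - 1` and `n - y` are exchanged; if too small, rows `y + 1` and
    -- `n - 1 - y`.
    suffices h : ¬ (n < 2 * y) ∧ ¬ (2 * y + 2 ≤ n) by omega
    refine ⟨fun h => ?_, fun h => ?_⟩
    · have h1 := hF.upper_row_lt hL hN (a := p - (y - 1)) (b := y - 1) (c := p + y - n)
        (d := n - y) hy (by omega) (by omega) (by omega) (by omega) (by omega)
      rcases Nat.lt_or_ge (p + 1) y with h' | h'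
      · have h2 := hF.wrap (a := p + y - n) (b := n - y) (d := y - 1) (by omega) (by omega)
          (by omega) (by omega)
        rw [show p - (y - 1) = 0 by omega] at h1
        exact lt_asymm h1 h2
      · have h2 := hF.upper_row_lt hL hN (a := p + y - n) (b := n - y) (c := p - (y - 1))
          (d := y - 1) hy (by omega) (by omega) (by omega) (by omega) (by omega)
        exact lt_asymm h1 h2
    · have h1 := hF.upper_row_gt hL hE (a := p - (y + 1)) (b := y + 1) (c := p - (n - 1 - y))
        (d := n - 1 - y) (by omega) (by omega) (by omega) (by omega) (by omega) (by omega)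
        (by omega)
      have h2 := hF.upper_row_gt hL hE (a := p - (n - 1 - y)) (b := n - 1 - y) (c := p - (y + 1))
        (d := y + 1) (by omega) (by omega) (by omega) (by omega) (by omega) (by omega) (by omega)
      exact lt_asymm h1 h2

end IsRank

/-! ### Hamiltonian paths as lists and as cyclic permutations -/

section Lists

variable {m n : ℕ}

theorem hasEdge_getElem (H : List (Square m n)) (i : ℕ) (hi : i + 1 < H.length) :
    HasEdge H H[i] H[i + 1] := by
  refine ⟨H.take i, H.drop (i + 2), ?_⟩
  rw [List.append_assoc]
  conv_rhs => rw [← List.take_append_drop i H, List.drop_eq_getElem_cons (by omega : i < H.length),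
    List.drop_eq_getElem_cons hi]
  rfl

theorem HasEdge.idxOf_eq {H : List (Square m n)} (hH : H.Nodup) {σ ρ : Square m n}
    (h : HasEdge H σ ρ) : H.idxOf ρ = H.idxOf σ + 1 := by
  obtain ⟨s, t, rfl⟩ := h
  have h1 : σ = (s ++ [σ, ρ] ++ t)[s.length]'(by simp) := by simp
  have h2 : ρ = (s ++ [σ, ρ] ++ t)[s.length + 1]'(by simp) := by simp
  have e1 := hH.idxOf_getElem s.length (by simp)
  have e2 := hH.idxOf_getElem (s.length + 1) (by simp)
  rw [← h1] at e1
  rw [← h2] at e2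
  omega

theorem IsHamiltonianPath.idxOf_step {H : List (Square m n)} {ι τ : Square m n}
    (h : IsHamiltonianPath H ι τ) {σ : Square m n} (hσ : σ ≠ τ) :
    H.idxOf (stepE σ) = H.idxOf σ + 1 ∨ H.idxOf (stepN σ) = H.idxOf σ + 1 := by
  have hi : H.idxOf σ < H.length := List.idxOf_lt_length_of_mem (h.visits_all σ)
  have hget : H[H.idxOf σ] = σ := List.getElem_idxOf hi
  have hi' : H.idxOf σ + 1 < H.length := by
    by_contra hcon
    apply hσ
    have h1 : H.length - 1 = H.idxOf σ := by omega
    have h2 := h.terminal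
    rw [List.getLast?_eq_getElem?, h1, List.getElem?_eq_getElem hi, hget] at h2
    exact Option.some.inj h2
  have hadj := (List.isChain_iff_getElem.mp h.chain) (H.idxOf σ) hi'
  have hidx := h.nodup.idxOf_getElem _ hi'
  rw [hget] at hadj
  rcases hadj with hadj | hadj
  · left; rw [← hadj]; exact hidx
  · right; rw [← hadj]; exact hidx

/-- An injective choice of an out-neighbour at each non-terminal square, closed up by sending the
terminal square to the initial one, traces out a hamiltonian path if every square is carried to
the terminal one. -/
theorem exists_isHamiltonianPath (f : Square m n → Square m n) (hf : Function.Injective f)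
    (ι τ : Square m n) (hτ : f τ = ι) (hadj : ∀ σ, σ ≠ τ → (board m n).Adj σ (f σ))
    (hreach : ∀ σ, ∃ k : ℕ, f^[k] σ = τ) :
    ∃ H, IsHamiltonianPath H ι τ ∧ ∀ σ, σ ≠ τ → HasEdge H σ (f σ) := by
  classical
  let π : Equiv.Perm (Square m n) := Equiv.ofBijective f (Finite.injective_iff_bijective.mp hf)
  have hπ : ∀ σ, π σ = f σ := fun σ => rfl
  have hsame : ∀ σ, π.SameCycle σ τ := by
    intro σ
    obtain ⟨k, hk⟩ := hreach σ
    refine ⟨(k : ℤ), ?_⟩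
    rw [zpow_natCast, Equiv.Perm.coe_pow]
    exact hk
  have hcyc : π.IsCycleOn ((Finset.univ : Finset (Square m n)) : Set (Square m n)) := by
    refine ⟨by simp, fun σ _ ρ _ =>
      (hsame σ).trans (hsame ρ).symm⟩
  set N := (Finset.univ : Finset (Square m n)).card with hN
  have hNpos : 0 < N := Finset.card_pos.mpr ⟨τ, Finset.mem_univ τ⟩
  let H : List (Square m n) := (List.range N).map fun i => (π ^ i) ι
  have hlen : H.length = N := by simp [H]
  have hget : ∀ i (hi : i < H.length), H[i] = (π ^ i) ι := fun i hi => by simp [H]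
  have hlast : (π ^ (N - 1)) ι = τ := by
    apply hf
    rw [hτ, ← hπ, ← Equiv.Perm.mul_apply, ← pow_succ', Nat.sub_add_cancel hNpos]
    exact hcyc.pow_card_apply (Finset.mem_univ ι)
  have hsucc : ∀ i, (π ^ (i + 1)) ι = f ((π ^ i) ι) := fun i => by
    rw [pow_succ', Equiv.Perm.mul_apply, hπ]
  have hinj : ∀ i < N, ∀ j < N, (π ^ i) ι = (π ^ j) ι → i = j := fun i hi j hj h =>
    ((hcyc.pow_apply_eq_pow_apply (Finset.mem_univ ι)).mp h).eq_of_lt_of_lt hi hj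
  have hall : ∀ σ, ∃ i < N, (π ^ i) ι = σ := fun σ =>
    hcyc.exists_pow_eq (Finset.mem_univ ι) (Finset.mem_univ σ)
  have hne : ∀ i, i + 1 < N → (π ^ i) ι ≠ τ := fun i hi h => by
    have := hinj i (by omega) (N - 1) (by omega) (h.trans hlast.symm)
    omega
  refine ⟨H, ⟨?_, ?_, ?_, ?_, ?_⟩, ?_⟩
  · rw [List.isChain_iff_getElem]
    intro i hi
    rw [hget, hget, hsucc]
    exact hadj _ (hne i (by omega))
  · refine List.Nodup.map_on ?_ List.nodup_range
    intro i hi j hj h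
    exact hinj i (List.mem_range.mp hi) j (List.mem_range.mp hj) h
  · intro σ
    obtain ⟨i, hi, rfl⟩ := hall σ
    exact List.mem_map.mpr ⟨i, List.mem_range.mpr hi, rfl⟩
  · rw [List.head?_eq_getElem?, List.getElem?_eq_getElem (by omega), hget]
    rfl
  · rw [List.getLast?_eq_getElem?, List.getElem?_eq_getElem (by omega), hget, hlen, hlast]
  · intro σ hσ
    obtain ⟨i, hi, rfl⟩ := hall σ
    have hi' : i + 1 < N := by
      by_contra hcon
      exact hσ (by rw [← hlast]; congr 2; omega)
    have := hasEdge_getElem H i (by omega)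
    rwa [hget, hget, hsucc] at this

end Lists

theorem stepE_of_lt {m n a b : ℕ} (ha : a < m) (hb : b < n) (h : a + 1 < m) :
    stepE ((⟨a, ha⟩, ⟨b, hb⟩) : Square m n) = (⟨a + 1, h⟩, ⟨b, hb⟩) := by
  have : a < m - 1 := by omega
  simp [stepE, this]

theorem stepE_of_eq {m n a b : ℕ} (ha : a < m) (hb : b < n) (h : a + 1 = m) :
    stepE ((⟨a, ha⟩, ⟨b, hb⟩) : Square m n) = (⟨0, by omega⟩, ⟨n - 1 - b, by omega⟩) := by
  have : ¬ a < m - 1 := by omega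
  simp [stepE, this, Fin.ext_iff, Fin.val_rev]
  omega

theorem stepN_of_lt {m n a b : ℕ} (ha : a < m) (hb : b < n) (h : b + 1 < n) :
    stepN ((⟨a, ha⟩, ⟨b, hb⟩) : Square m n) = (⟨a, ha⟩, ⟨b + 1, h⟩) := by
  have : b < n - 1 := by omega
  simp [stepN, this]

theorem stepN_of_eq {m n a b : ℕ} (ha : a < m) (hb : b < n) (h : b + 1 = n) :
    stepN ((⟨a, ha⟩, ⟨b, hb⟩) : Square m n) = (⟨m - 1 - a, by omega⟩, ⟨0, by omega⟩) := by
  have : ¬ b < n - 1 := by omega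
  simp [stepN, this, Fin.ext_iff, Fin.val_rev]
  omega

/-! ### Diagonals as unions of two subdiagonals -/

section Diagonals

variable {m n : ℕ}

theorem sim_self (σ : Square m n) : Sim σ σ := ⟨stepE σ, by simp⟩

theorem Sim.sum_eq {σ ρ : Square m n} (h : Sim σ ρ) :
    (σ.1 : ℕ) + σ.2 = ρ.1 + ρ.2 ∨ (σ.1 : ℕ) + σ.2 + ρ.1 + ρ.2 + 3 = m + n := by
  obtain ⟨⟨a, ha⟩, ⟨b, hb⟩⟩ := σ
  obtain ⟨⟨c, hc⟩, ⟨d, hd⟩⟩ := ρ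
  obtain ⟨ρ, h1, h2⟩ := h
  simp only [Set.mem_insert_iff, Set.mem_singleton_iff] at h1 h2
  have hE : ∀ a b (ha : a < m) (hb : b < n), ρ = stepE ((⟨a, ha⟩, ⟨b, hb⟩) : Square m n) →
      (ρ.1 : ℕ) + ρ.2 = a + b + 1 ∨ (ρ.1 : ℕ) + ρ.2 + a + b + 2 = m + n := by
    rintro a b ha hb rfl
    rcases Nat.lt_or_ge (a + 1) m with h | h
    · rw [stepE_of_lt ha hb h]; simp only; omega
    · rw [stepE_of_eq ha hb (by omega)]; simp only; omega
  have hN : ∀ a b (ha : a < m) (hb : b < n), ρ = stepN ((⟨a, ha⟩, ⟨b, hb⟩) : Square m n) →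
      (ρ.1 : ℕ) + ρ.2 = a + b + 1 ∨ (ρ.1 : ℕ) + ρ.2 + a + b + 2 = m + n := by
    rintro a b ha hb rfl
    rcases Nat.lt_or_ge (b + 1) n with h | h
    · rw [stepN_of_lt ha hb h]; simp only; omega
    · rw [stepN_of_eq ha hb (by omega)]; simp only; omega
  have h1' := h1.elim (hE a b ha hb) (hN a b ha hb)
  have h2' := h2.elim (hE c d hc hd) (hN c d hc hd)
  simp only
  omega

theorem transGen_sim_sum_eq {σ ρ : Square m n} (h : Relation.TransGen Sim σ ρ) :
    (ρ.1 : ℕ) + ρ.2 = σ.1 + σ.2 ∨ (σ.1 : ℕ) + σ.2 + ρ.1 + ρ.2 + 3 = m + n := by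
  induction h with
  | single h => have := h.sum_eq; omega
  | tail _ h ih => have := h.sum_eq; omega

theorem transGen_sim_of_sum {a b c d : ℕ} (ha : a < m) (hb : b < n) (hc : c < m) (hd : d < n)
    (h : a + b + c + d + 3 = m + n) :
    Relation.TransGen Sim ((⟨a, ha⟩, ⟨b, hb⟩) : Square m n) (⟨c, hc⟩, ⟨d, hd⟩) := by
  have key := across_diagonal (m := m) (n := n) (Q := fun a' b' => ∃ (ha' : a' < m) (hb' : b' < n),
    Relation.TransGen Sim ((⟨a, ha⟩, ⟨b, hb⟩) : Square m n) (⟨a', ha'⟩, ⟨b', hb'⟩)) ?_ ?_ ?_ h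
    ha hb hc hd ⟨ha, hb, Relation.TransGen.single (sim_self _)⟩
  · exact key.2.2
  · rintro a' b' ha' hb' ⟨h1, h2, h3⟩
    refine ⟨ha', by omega, h3.tail ⟨(⟨a' + 1, ha'⟩, ⟨b' + 1, hb'⟩), ?_, ?_⟩⟩
    · left; rw [stepE_of_lt h1 h2 ha']
    · right; rw [stepN_of_lt ha' (by omega) hb']; rfl
  · rintro a' c' hac ⟨h1, h2, h3⟩
    refine ⟨by omega, by omega, h3.tail ⟨(⟨a' + 1, by omega⟩, ⟨0, h2⟩), ?_, ?_⟩⟩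
    · left; rw [stepE_of_lt h1 h2 (by omega)]
    · right
      rw [stepN_of_eq (by omega) (by omega) (by omega)]
      simp only [Set.mem_singleton_iff, Prod.mk.injEq, Fin.mk.injEq, and_true]
      omega
  · rintro b' d' hbd ⟨h1, h2, h3⟩
    refine ⟨by omega, by omega, h3.tail ⟨(⟨0, by omega⟩, ⟨d' + 1, by omega⟩), ?_, ?_⟩⟩
    · left
      rw [stepE_of_eq h1 h2 (by omega)]
      simp only [Prod.mk.injEq, Fin.mk.injEq, true_and]
      omega
    · right; rw [stepN_of_lt (by omega) (by omega) (by omega)]; rfl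

theorem diagonal_eq (hm : 3 ≤ m) (hn : 3 ≤ n) {i j : ℕ} (hij : i + j + 3 = m + n)
    {σ : Square m n} (hσ : (σ.1 : ℕ) + σ.2 = i ∨ (σ.1 : ℕ) + σ.2 = j) :
    diagonal σ = subdiagonal m n i ∪ subdiagonal m n j := by
  obtain ⟨⟨a, ha⟩, ⟨b, hb⟩⟩ := σ
  simp only at hσ
  ext ⟨⟨c, hc⟩, ⟨d, hd⟩⟩
  simp only [diagonal, subdiagonal, Set.mem_ofPred_eq, Set.mem_union]
  constructor
  · intro h
    have := transGen_sim_sum_eq h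
    simp only at this
    omega
  · intro h
    by_cases h' : a + b + c + d + 3 = m + n
    · exact transGen_sim_of_sum ha hb hc hd h'
    · obtain ⟨e, f, he, hf, hef⟩ : ∃ e f, e < m ∧ f < n ∧ a + b + e + f + 3 = m + n := by
        rcases Nat.lt_or_ge (m + n - 3 - (a + b)) m with h | h
        · exact ⟨m + n - 3 - (a + b), 0, by omega, by omega, by omega⟩
        · exact ⟨m - 1, n - 2 - (a + b), by omega, by omega, by omega⟩
      exact (transGen_sim_of_sum ha hb he hf hef).trans
        (transGen_sim_of_sum he hf hc hd (by omega))

end Diagonals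

/-! ### Paths prescribed by a set of squares travelling north -/

section Successor

variable {m n : ℕ} (W : ℕ → ℕ → Prop) [DecidableRel W] (ι τ : Square m n)

/-- The terminal square is followed by the initial one; any other square is followed by its
northern neighbour if it satisfies `W`, and by its eastern neighbour if it does not. -/
def successor (σ : Square m n) : Square m n :=
  if σ = τ then ι else if W σ.1 σ.2 then stepN σ else stepE σ

/-- The square `(a, b)` is carried to the terminal square by the successor function. -/
def ReachesTerminal (a b : ℕ) : Prop :=
  ∀ (ha : a < m) (hb : b < n), ∃ k : ℕ, (successor W ι τ)^[k] (⟨a, ha⟩, ⟨b, hb⟩) = τ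

variable {W ι τ}

theorem successor_terminal : successor W ι τ τ = ι := by simp [successor]

theorem successor_north {σ : Square m n} (h : σ ≠ τ) (hW : W σ.1 σ.2) :
    successor W ι τ σ = stepN σ := by simp [successor, h, hW]

theorem successor_east {σ : Square m n} (h : σ ≠ τ) (hW : ¬ W σ.1 σ.2) :
    successor W ι τ σ = stepE σ := by simp [successor, h, hW]

theorem reachesTerminal_of_successor {a b c d : ℕ} (hc : c < m) (hd : d < n)
    (h : ∀ (ha : a < m) (hb : b < n), successor W ι τ (⟨a, ha⟩, ⟨b, hb⟩) = (⟨c, hc⟩, ⟨d, hd⟩))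
    (h' : ReachesTerminal W ι τ c d) : ReachesTerminal W ι τ a b := by
  intro ha hb
  obtain ⟨k, hk⟩ := h' hc hd
  exact ⟨k + 1, by rw [Function.iterate_succ_apply, h ha hb, hk]⟩

theorem reachesTerminal_east {a b : ℕ} (hb : b < n) (hW : ¬ W a b)
    (hτ : ¬ (a = τ.1 ∧ b = τ.2)) :
    EastStep m n (fun a b c d => ReachesTerminal W ι τ c d → ReachesTerminal W ι τ a b) a b := by
  have hne : ∀ (ha : a < m), ((⟨a, ha⟩, ⟨b, hb⟩) : Square m n) ≠ τ := by
    rintro ha rfl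
    exact hτ ⟨rfl, rfl⟩
  refine ⟨fun h => reachesTerminal_of_successor h hb fun ha _ => ?_,
    fun h => reachesTerminal_of_successor (by omega) (by omega) fun ha _ => ?_⟩
  · rw [successor_east (hne ha) hW, stepE_of_lt ha hb h]
  · rw [successor_east (hne ha) hW, stepE_of_eq ha hb h]

theorem reachesTerminal_north {a b : ℕ} (ha : a < m) (hb : b + 1 < n) (hW : W a b)
    (hτ : ¬ (a = τ.1 ∧ b = τ.2)) (h : ReachesTerminal W ι τ a (b + 1)) :
    ReachesTerminal W ι τ a b := by
  refine reachesTerminal_of_successor ha hb (fun _ hb' => ?_) h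
  rw [successor_north (by rintro rfl; exact hτ ⟨rfl, rfl⟩) hW, stepN_of_lt ha hb' hb]

theorem reachesTerminal_terminal : ReachesTerminal W ι τ τ.1 τ.2 := fun _ _ => ⟨0, rfl⟩

theorem reachesTerminal_east_walk {a b c : ℕ} (hb : b < n) (hac : a ≤ c) (hc : c < m)
    (hE : ∀ e, a ≤ e → e < c → ¬ W e b ∧ ¬ (e = τ.1 ∧ b = τ.2))
    (h : ReachesTerminal W ι τ c b) : ReachesTerminal W ι τ a b := by
  obtain ⟨k, rfl⟩ : ∃ k, c = a + k := ⟨c - a, by omega⟩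
  induction k generalizing a with
  | zero => exact h
  | succ k ih =>
    have h0 := hE a le_rfl (by omega)
    refine (reachesTerminal_east hb h0.1 h0.2).1 (by omega) (ih (a := a + 1) (by omega) (by omega)
      (fun e he he' => hE e (by omega) (by omega)) ?_)
    rwa [show a + 1 + k = a + (k + 1) by omega]

/-- By `h1` no northward step wraps, so the only possible collisions are a northward step with an
eastward one, excluded by `h2` and `h3`, and an eastward step into the initial square, excluded by
`h4`. -/
theorem successor_injective {p : ℕ} (hm : 3 ≤ m) (hp : 1 ≤ p)
    (hι : (ι.1 : ℕ) = p ∧ (ι.2 : ℕ) = 0)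
    (h1 : ∀ a b, a < m → b < n → W a b → b + 1 < n)
    (h2 : ∀ a b, a + 1 < m → b + 1 < n → W (a + 1) b →
      W a (b + 1) ∨ (a = τ.1 ∧ b + 1 = τ.2))
    (h3 : ∀ b d, b + d + 2 = n → W 0 d → W (m - 1) b ∨ (m - 1 = τ.1 ∧ b = τ.2))
    (h4 : W (p - 1) 0 ∨ (p - 1 = τ.1 ∧ 0 = (τ.2 : ℕ))) :
    Function.Injective (successor W ι τ) := by
  have hcases : ∀ (σ : Square m n),
      ((σ.1 : ℕ) = τ.1 ∧ (σ.2 : ℕ) = τ.2 ∧ ((successor W ι τ σ).1 : ℕ) = p ∧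
        ((successor W ι τ σ).2 : ℕ) = 0) ∨
      (W σ.1 σ.2 ∧ ((successor W ι τ σ).1 : ℕ) = σ.1 ∧
        ((successor W ι τ σ).2 : ℕ) = σ.2 + 1) ∨
      (¬ ((σ.1 : ℕ) = τ.1 ∧ (σ.2 : ℕ) = τ.2) ∧ ¬ W σ.1 σ.2 ∧ (σ.1 : ℕ) + 1 < m ∧
        ((successor W ι τ σ).1 : ℕ) = σ.1 + 1 ∧ ((successor W ι τ σ).2 : ℕ) = σ.2) ∨
      (¬ ((σ.1 : ℕ) = τ.1 ∧ (σ.2 : ℕ) = τ.2) ∧ ¬ W σ.1 σ.2 ∧ (σ.1 : ℕ) + 1 = m ∧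
        ((successor W ι τ σ).1 : ℕ) = 0 ∧ ((successor W ι τ σ).2 : ℕ) + σ.2 + 1 = n) := by
    intro σ
    by_cases hσ : σ = τ
    · subst hσ
      exact Or.inl ⟨rfl, rfl, by rw [successor_terminal]; exact hι⟩
    · have hσ' : ¬ ((σ.1 : ℕ) = τ.1 ∧ (σ.2 : ℕ) = τ.2) := fun h =>
        hσ (Prod.ext (Fin.ext h.1) (Fin.ext h.2))
      obtain ⟨⟨a, ha⟩, ⟨b, hb⟩⟩ := σ
      by_cases hW : W a b
      · right; left
        rw [successor_north hσ hW, stepN_of_lt ha hb (h1 a b ha hb hW)]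
        exact ⟨hW, rfl, rfl⟩
      · right; right
        rcases Nat.lt_or_ge (a + 1) m with h | h
        · left
          rw [successor_east hσ hW, stepE_of_lt ha hb h]
          exact ⟨hσ', hW, h, rfl, rfl⟩
        · right
          rw [successor_east hσ hW, stepE_of_eq ha hb (by omega)]
          refine ⟨hσ', hW, by simp only; omega, rfl, by simp only; omega⟩
  intro σ ρ hσρ
  have hσ := hcases σ
  have hρ := hcases ρ
  rw [hσρ] at hσ
  obtain ⟨⟨a, ha⟩, ⟨b, hb⟩⟩ := σ
  obtain ⟨⟨c, hc⟩, ⟨d, hd⟩⟩ := ρ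
  generalize ((successor W ι τ (⟨c, hc⟩, ⟨d, hd⟩)).1 : ℕ) = e at hσ hρ
  generalize ((successor W ι τ (⟨c, hc⟩, ⟨d, hd⟩)).2 : ℕ) = f at hσ hρ
  simp only at hσ hρ
  suffices h : a = c ∧ b = d by
    obtain ⟨rfl, rfl⟩ := h
    rfl
  have h2' : ∀ a b c d, a + 1 = c → b = d + 1 → c < m → b < n → W c d →
      ¬ W a b → ¬ (a = τ.1 ∧ b = τ.2) → False := by
    rintro a b c d rfl rfl hc hd hW hW' hτ
    exact (h2 a d hc hd hW).elim hW' hτ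
  have h3' : ∀ a b c d, a + 1 = m → c = 0 → d + 1 + b + 1 = n → W c d →
      ¬ W a b → ¬ (a = τ.1 ∧ b = τ.2) → False := by
    rintro a b c d ha rfl hd hW hW' hτ
    obtain rfl : a = m - 1 := by omega
    exact (h3 b d (by omega) hW).elim hW' hτ
  have h4' : ∀ a b, a + 1 = p → b = 0 → ¬ W a b → ¬ (a = τ.1 ∧ b = τ.2) → False := by
    rintro a b ha rfl hW' hτ
    obtain rfl : a = p - 1 := by omega
    exact h4.elim hW' hτ
  rcases hσ with ⟨q1, q2, q3, q4⟩ | ⟨q1, q2, q3⟩ | ⟨q1, q2, q3, q4, q5⟩ | ⟨q1, q2, q3, q4, q5⟩ <;>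
  rcases hρ with ⟨s1, s2, s3, s4⟩ | ⟨s1, s2, s3⟩ | ⟨s1, s2, s3, s4, s5⟩ | ⟨s1, s2, s3, s4, s5⟩ <;>
  first
  | omega
  | exact (h4' a b (by omega) (by omega) q2 q1).elim
  | exact (h4' c d (by omega) (by omega) s2 s1).elim
  | exact (h2' a b c d (by omega) (by omega) hc hb s1 q2 q1).elim
  | exact (h2' c d a b (by omega) (by omega) ha hd q1 s2 s1).elim
  | exact (h3' a b c d (by omega) (by omega) (by omega) s1 q2 q1).elim
  | exact (h3' c d a b (by omega) (by omega) (by omega) q1 s2 s1).elim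

theorem successor_isFlow {p : ℕ} (hp2 : 2 * p + 2 ≤ m + n)
    (hτ : (τ.1 : ℕ) + τ.2 + 1 = p ∨ (τ.1 : ℕ) + τ.2 + p + 2 = m + n)
    (hW : ∀ a b, W a b → a + b + 1 = p ∨ a + b + p + 2 = m + n) :
    IsFlow m n p (fun a b c d => ReachesTerminal W ι τ c d → ReachesTerminal W ι τ a b) where
  trans := fun h h' h'' => h (h' h'')
  inner := fun a b ha hb h h' => reachesTerminal_east hb (fun hc => by have := hW _ _ hc; omega)
    (by omega)
  outer := fun a b c d h hac hbd h' => by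
    -- Every outer square travels east here, so the half-turn is a walk to the right edge, one wrap,
    -- and a walk from the left edge.
    refine reachesTerminal_east_walk (c := m - 1) (by omega) (by omega) (by omega)
      (fun e he he' => ⟨fun hc => by have := hW _ _ hc; omega, by omega⟩)
      ((reachesTerminal_east (by omega) (fun hc => by have := hW _ _ hc; omega) (by omega)).wrap
        (d := d) (by omega) (by omega) ?_)
    exact reachesTerminal_east_walk (c := c) (by omega) (by omega) (by omega)
      (fun e he he' => ⟨fun hc => by have := hW _ _ hc; omega, by omega⟩) h'

/-- It is enough to carry the squares between the two halves of the terminal diagonal to the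
terminal square. -/
theorem reachesTerminal_of_inner {p : ℕ} (hpm : p < m) (hp2 : 2 * p + 2 ≤ m + n)
    (hτ : (τ.1 : ℕ) + τ.2 + 1 = p ∨ (τ.1 : ℕ) + τ.2 + p + 2 = m + n)
    (hW : ∀ a b, W a b → a + b + 1 = p ∨ a + b + p + 2 = m + n)
    (hWn : ∀ a b, a < m → b < n → W a b → b + 1 < n)
    (hI : ∀ a b, a < m → b < n → p ≤ a + b → a + b + p + 2 ≤ m + n → ReachesTerminal W ι τ a b)
    {a b : ℕ} (ha : a < m) (hb : b < n) : ReachesTerminal W ι τ a b := by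
  have hlow : ∀ a b, b < n → a + b + 1 = p → ReachesTerminal W ι τ a b := by
    intro a b hb hab
    by_cases h : a = τ.1 ∧ b = τ.2
    · rw [h.1, h.2]; exact reachesTerminal_terminal
    · by_cases hc : W a b
      · have hb' := hWn a b (by omega) hb hc
        exact reachesTerminal_north (by omega) hb' hc h
          (hI _ _ (by omega) hb' (by omega) (by omega))
      · exact (reachesTerminal_east hb hc h).1 (by omega)
          (hI _ _ (by omega) hb (by omega) (by omega))
  have hlow' : ∀ a b, b < n → a + b + 1 ≤ p → ReachesTerminal W ι τ a b := fun a b hb hab =>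
    reachesTerminal_east_walk (c := p - 1 - b) hb (by omega) (by omega)
      (fun e he he' => ⟨fun hc => by have := hW _ _ hc; omega, by omega⟩)
      (hlow _ _ hb (by omega))
  by_cases h : p ≤ a + b
  · by_cases h' : a + b + p + 2 ≤ m + n
    · exact hI a b ha hb h h'
    · exact (successor_isFlow hp2 hτ hW).outer a b (m - 1 - a) (n - 1 - b) (by omega)
        (by omega) (by omega) (hlow' _ _ (by omega) (by omega))
  · exact hlow' a b hb (by omega)

end Successor

/-! ### Sufficiency: the two explicit paths -/

section Sufficiency

variable {m n p : ℕ}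

/-- The non-terminal squares travelling north when the terminal square is in row `y` of the lower
half of the terminal diagonal. -/
abbrev NorthLower (p y a b : ℕ) : Prop := a + b + 1 = p ∧ b < y

/-- The non-terminal squares travelling north when the terminal square is in row `y` of the upper
half of the terminal diagonal. -/
abbrev NorthUpper (m n p y a b : ℕ) : Prop :=
  a + b + 1 = p ∨ (a + b + p + 2 = m + n ∧ b < y)

theorem reachesTerminal_northLower {ι τ : Square m n} (hpm : p < m)
    (hp2 : 2 * p + 2 ≤ m + n) (hτ : (τ.1 : ℕ) + τ.2 + 1 = p) (hy : (τ.2 : ℕ) = (n - 1) / 2)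
    (a b : ℕ) : ReachesTerminal (NorthLower p τ.2) ι τ a b := by
  intro ha hb
  obtain ⟨y, hyτ⟩ : ∃ y, y = (τ.2 : ℕ) := ⟨_, rfl⟩
  have hyn : y < n := by have := τ.2.isLt; omega
  rw [← hyτ] at hτ hy ⊢
  have hW : ∀ a b, NorthLower p y a b → a + b + 1 = p ∨ a + b + p + 2 = m + n :=
    fun a b h => Or.inl h.1
  have hF := successor_isFlow (ι := ι) (τ := τ) (W := NorthLower p y) hp2 (by omega) hW
  have hU : ∀ a b, a < m → b < n → a + b + p + 2 = m + n → EastStep m n (fun a b c d =>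
      ReachesTerminal (NorthLower p y) ι τ c d → ReachesTerminal (NorthLower p y) ι τ a b) a b :=
    fun a b ha hb h => reachesTerminal_east hb (by omega) (by omega)
  have hE : ∀ a b, a + b + 1 = p → b < n → y < b → EastStep m n (fun a b c d =>
      ReachesTerminal (NorthLower p y) ι τ c d → ReachesTerminal (NorthLower p y) ι τ a b) a b :=
    fun a b ha hb h => reachesTerminal_east hb (by omega) (by omega)
  have hN : ∀ a b, a + b + 1 = p → b < y → ReachesTerminal (NorthLower p y) ι τ a (b + 1) →
      ReachesTerminal (NorthLower p y) ι τ a b := fun a b hab hb =>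
    reachesTerminal_north (by omega) (by omega) ⟨hab, hb⟩ (by omega)
  have h0 : ReachesTerminal (NorthLower p y) ι τ τ.1 y := by
    rw [hyτ]; exact reachesTerminal_terminal
  have hlow : ∀ k b, b + k = y → ∀ a, a < m → p ≤ a + b → a + b + p + 2 ≤ m + n →
      ReachesTerminal (NorthLower p y) ι τ a b := by
    intro k
    induction k with
    | zero =>
      rintro b rfl a ha h h'
      -- For odd `n`, row `y` leads straight to the end; for even `n` it passes first through row `n
      -- - 1 - y = y + 1`.
      by_cases hby : b + b + 1 = n
      · exact hF.lower_row_eq hU hτ ha h h' (by omega) h0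
      · refine hF.lower_row_gt hU hpm hE ha h h' (d := n - 1 - b) (by omega) (by omega) ?_
        exact hF.lower_row_eq hU hτ (by omega) (by omega) (by omega) (by omega) h0
    | succ k ih =>
      rintro b hb a ha h h'
      -- Two reflections, `b ↦ n - 1 - b ↦ b + 1`, bring the row one closer to `y`.
      refine hF.lower_row_gt hU hpm hE ha h h' (d := n - 1 - b) (by omega) (by omega) ?_
      exact hF.lower_row_lt hU hN (c := p - (b + 1)) (d := b + 1) (by omega) (by omega) (by omega)
        (by omega) (by omega) (by omega) (by omega)
        (ih (b + 1) (by omega) _ (by omega) (by omega) (by omega))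
  refine reachesTerminal_of_inner hpm hp2 (by omega) hW (fun a b ha hb h => by omega) ?_
    ha hb ha hb
  intro a b ha hb h h'
  rcases Nat.lt_or_ge y b with hby | hby
  · by_cases hb' : y + b + 1 = n
    · exact hF.lower_row_eq hU hτ ha h h' hb' h0
    · exact hF.lower_row_lt hU hN (c := p - (n - b)) (d := n - b) ha h h'
        (by omega) (by omega) (by omega) (by omega)
        (hlow (y - (n - b)) _ (by omega) _ (by omega) (by omega) (by omega))
  · exact hlow (y - b) b (by omega) a ha h h'

theorem reachesTerminal_northUpper {ι τ : Square m n} (hpm : p < m) (hpn : p < n)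
    (hp2 : 2 * p + 2 ≤ m + n) (hτ : (τ.1 : ℕ) + τ.2 + p + 2 = m + n) (hy : (τ.2 : ℕ) = n / 2)
    (a b : ℕ) : ReachesTerminal (NorthUpper m n p τ.2) ι τ a b := by
  intro ha hb
  obtain ⟨y, hyτ⟩ : ∃ y, y = (τ.2 : ℕ) := ⟨_, rfl⟩
  have hyn : y < n := by have := τ.2.isLt; omega
  have hxm := τ.1.isLt
  rw [← hyτ] at hτ hy ⊢
  have hW : ∀ a b, NorthUpper m n p y a b → a + b + 1 = p ∨ a + b + p + 2 = m + n :=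
    fun a b h => by omega
  have hF := successor_isFlow (ι := ι) (τ := τ) (W := NorthUpper m n p y) hp2 (by omega) hW
  have hE : ∀ a b, a < m → b < n → a + b + p + 2 = m + n → y < b → EastStep m n (fun a b c d =>
      ReachesTerminal (NorthUpper m n p y) ι τ c d →
        ReachesTerminal (NorthUpper m n p y) ι τ a b) a b :=
    fun a b ha hb h hby => reachesTerminal_east hb (by omega) (by omega)
  have hN : ∀ a b, a < m → a + b + p + 2 = m + n → b < y →
      ReachesTerminal (NorthUpper m n p y) ι τ a (b + 1) →
      ReachesTerminal (NorthUpper m n p y) ι τ a b := fun a b ha hab hb =>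
    reachesTerminal_north ha (by omega) (Or.inr ⟨hab, hb⟩) (by omega)
  have hL : ∀ a b, a + b + 1 = p → ReachesTerminal (NorthUpper m n p y) ι τ a (b + 1) →
      ReachesTerminal (NorthUpper m n p y) ι τ a b := fun a b hab =>
    reachesTerminal_north (by omega) (by omega) (Or.inl hab) (by omega)
  have h0 : ReachesTerminal (NorthUpper m n p y) ι τ τ.1 y := by
    rw [hyτ]; exact reachesTerminal_terminal
  have heq : ∀ a b, p ≤ a + b → a + b + p + 2 ≤ m + n → b = y →
      ReachesTerminal (NorthUpper m n p y) ι τ a b := by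
    intro a b h h' hb
    rcases hF.upper_row_eq h h' hxm hyn hτ hb with ⟨rfl, rfl⟩ | h
    · exact h0
    · exact h h0
  have hlow : ∀ k b, b + k = y → ∀ a, a < m → p ≤ a + b → a + b + p + 2 ≤ m + n →
      ReachesTerminal (NorthUpper m n p y) ι τ a b := by
    intro k
    induction k with
    | zero =>
      rintro b hb a ha h h'
      exact heq a b h h' (by omega)
    | succ k ih =>
      rintro b hb a ha h h'
      -- The reflected row `n - 1 - b` is either `y` itself or is reflected again to row `b + 1`.
      have hnext : ∀ c, c < m → p ≤ c + (n - 1 - b) → c + (n - 1 - b) + p + 2 ≤ m + n →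
          ReachesTerminal (NorthUpper m n p y) ι τ c (n - 1 - b) := by
        intro c hc h1 h2
        by_cases hb' : n - 1 - b = y
        · exact heq _ _ h1 h2 hb'
        · exact hF.upper_row_gt hL hE (c := p - (b + 1)) (d := b + 1) (by omega) h1 h2 (by omega)
            (by omega) (by omega) (by omega)
            (ih (b + 1) (by omega) _ (by omega) (by omega) (by omega))
      by_cases hpb : p + b + 2 ≤ n
      · exact hF.wrap ha hpb h (d := n - 1 - b) (by omega)
          (hnext _ (by omega) (by omega) (by omega))
      · exact hF.upper_row_lt hL hN hyn h h' (by omega) (c := p - (n - 1 - b)) (d := n - 1 - b)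
          (by omega) (by omega) (hnext _ (by omega) (by omega) (by omega))
  refine reachesTerminal_of_inner hpm hp2 (by omega) hW (fun a b ha hb h => by omega) ?_
    ha hb ha hb
  intro a b ha hb h h'
  rcases Nat.lt_or_ge y b with hby | hby
  · exact hF.upper_row_gt hL hE (c := p - (n - b)) (d := n - b) (by omega) h h' hby hb
        (by omega) (by omega) (hlow (y - (n - b)) _ (by omega) _ (by omega) (by omega) (by omega))
  · exact hlow (y - b) b (by omega) a ha h h'

theorem exists_path_of_successor (W : ℕ → ℕ → Prop) [DecidableRel W] {ι τ : Square m n}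
    (hinj : Function.Injective (successor W ι τ))
    (hτ : (τ.1 : ℕ) + τ.2 + 1 = p ∨ (τ.1 : ℕ) + τ.2 + p + 2 = m + n)
    (hp2 : 2 * p + 2 ≤ m + n)
    (hW : ∀ a b, W a b → a + b + 1 = p ∨ a + b + p + 2 = m + n)
    (hreach : ∀ a b, ReachesTerminal W ι τ a b) :
    ∃ H : List (Square m n), IsHamiltonianPath H ι τ ∧
      ∀ D, IsInnerDiagonal τ D → ∀ σ ∈ D, TravelsEast H σ := by
  obtain ⟨H, hH, hH'⟩ := exists_isHamiltonianPath (successor W ι τ) hinj ι τ successor_terminal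
    (fun σ hσ => by
      by_cases h : W σ.1 σ.2
      · exact Or.inr (successor_north hσ h)
      · exact Or.inl (successor_east hσ h))
    (fun σ => hreach σ.1 σ.2 σ.1.isLt σ.2.isLt)
  refine ⟨H, hH, ?_⟩
  rintro D ⟨-, a, b, i, j, hab, habs, hD, hij, hijs, rfl, hai⟩ σ hσ
  have hmem : τ ∈ diagonal τ := Relation.TransGen.single (sim_self τ)
  rw [hD] at hmem
  simp only [subdiagonal, Set.mem_ofPred_eq, Set.mem_union] at hmem hσ
  have hne : σ ≠ τ := by
    rintro rfl
    omega
  have hnW : ¬ W σ.1 σ.2 := fun h => by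
    have := hW _ _ h
    omega
  have := hH' σ hne
  rwa [successor_east hne hnW] at this

end Sufficiency

/-! ### From lists to ranks, and the main theorem -/

theorem IsHamiltonianPath.isRank {m n : ℕ} {H : List (Square m n)} {ι τ : Square m n}
    (h : IsHamiltonianPath H ι τ) (hι : (ι.2 : ℕ) = 0) :
    IsRank m n ι.1 τ.1 τ.2 (fun a b => if hab : a < m ∧ b < n then
      H.idxOf ((⟨a, hab.1⟩, ⟨b, hab.2⟩) : Square m n) else 0) where
  inj := by
    intro a b c d ha hb hc hd heq
    simp only [ha, hb, hc, hd, and_self, dite_true] at heq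
    simpa using (List.idxOf_inj (h.visits_all _)).mp heq
  start := by
    have h0 : 0 < n := by have := ι.2.isLt; omega
    have hι' : ι = (ι.1, ⟨0, h0⟩) := Prod.ext rfl (Fin.ext hι)
    obtain ⟨t, ht⟩ : ∃ t, H = ι :: t := by
      have := h.initial
      cases H with
      | nil => simp at this
      | cons s t => exact ⟨t, by simp at this; rw [this]⟩
    simp only [ι.1.isLt, h0, and_self, dite_true, Fin.eta]
    rw [← hι', ht, List.idxOf_cons_self]
  step := by
    intro a b ha hb
    by_cases hτ : ((⟨a, ha⟩, ⟨b, hb⟩) : Square m n) = τ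
    · subst hτ
      exact Or.inl ⟨rfl, rfl⟩
    · right
      refine (h.idxOf_step hτ).imp (fun hs => ⟨fun h' => ?_, fun h' => ?_⟩)
        (fun hs => ⟨fun h' => ?_, fun h' => ?_⟩)
      · rw [stepE_of_lt ha hb h'] at hs
        simpa [ha, hb, h'] using hs
      · rw [stepE_of_eq ha hb h'] at hs
        have h1 : 0 < m := by omega
        have h2 : n - 1 - b < n := by omega
        simpa only [ha, hb, h1, h2, and_self, dite_true] using hs
      · rw [stepN_of_lt ha hb h'] at hs
        simpa [ha, hb, h'] using hs
      · rw [stepN_of_eq ha hb h'] at hs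
        have h1 : 0 < n := by omega
        have h2 : m - 1 - a < m := by omega
        simpa only [ha, hb, h1, h2, and_self, dite_true] using hs

theorem IsHamiltonianPath.goesEast {m n : ℕ} {H : List (Square m n)} {ι τ : Square m n}
    (h : IsHamiltonianPath H ι τ) {a b : ℕ} (ha : a < m) (hb : b < n)
    (hE : TravelsEast H (⟨a, ha⟩, ⟨b, hb⟩)) :
    GoesEast m n (fun a b => if hab : a < m ∧ b < n then
      H.idxOf ((⟨a, hab.1⟩, ⟨b, hab.2⟩) : Square m n) else 0) a b := by
  have hs := HasEdge.idxOf_eq h.nodup hE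
  refine ⟨fun h' => ?_, fun h' => ?_⟩
  · rw [stepE_of_lt ha hb h'] at hs
    simpa [ha, hb, h'] using hs
  · rw [stepE_of_eq ha hb h'] at hs
    have h1 : 0 < m := by omega
    have h2 : n - 1 - b < n := by omega
    simpa only [ha, hb, h1, h2, and_self, dite_true] using hs

end ProjectiveCheckerboard

theorem mainTheorem5 (m n : ℕ) (hmn : n ≤ m) (hn : 3 ≤ n)
    (p : Fin m) (hp1 : 1 ≤ (p : ℕ)) (hp2 : (p : ℕ) ≤ (m + n) / 2 - 1)
    (x : Fin m) (y : Fin n) :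
    (∃ H : List (ProjectiveCheckerboard.Square m n),
        ProjectiveCheckerboard.IsHamiltonianPath H (p, ⟨0, by omega⟩) (x, y) ∧
        ∀ D : Set (ProjectiveCheckerboard.Square m n),
          ProjectiveCheckerboard.IsInnerDiagonal (x, y) D →
          ∀ σ ∈ D, ProjectiveCheckerboard.TravelsEast H σ) ↔
      (((x : ℕ) + (y : ℕ) = (p : ℕ) - 1 ∧ (n - 1) / 2 ≤ (p : ℕ) - 1 ∧
          (y : ℕ) = (n - 1) / 2) ∨
        ((x : ℕ) + (y : ℕ) = m + n - (p : ℕ) - 2 ∧ (y : ℕ) = n / 2 ∧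
          (n - 1) / 2 ≤ (p : ℕ) ∧ (p : ℕ) ≤ n - 1)) := by
  have hpm := p.isLt
  have hxm := x.isLt
  have hyn := y.isLt
  have hp2' : 2 * (p : ℕ) + 2 ≤ m + n := by omega
  have hm : 3 ≤ m := by omega
  constructor
  · rintro ⟨H, hH, hI⟩
    have := (hH.isRank rfl).necessity hm hn hp1 hpm hp2' hxm hyn ?_
    · simp only at this
      omega
    · intro hτ a b ha hb hab hab'
      simp only at hτ hab hab'
      refine hH.goesEast ha hb (hI (ProjectiveCheckerboard.diagonal (⟨a, ha⟩, ⟨b, hb⟩))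
        -- `min` and `max` order the two halves of the diagonal, as `(a, b)` may lie in either.
        ⟨⟨_, rfl⟩, (p : ℕ) - 1, m + n - 2 - p, min (a + b) (m + n - 3 - (a + b)),
          max (a + b) (m + n - 3 - (a + b)), by omega, by omega, ?_, by omega, by omega, ?_,
          by omega⟩ _ (Relation.TransGen.single (ProjectiveCheckerboard.sim_self _)))
      · exact ProjectiveCheckerboard.diagonal_eq hm hn (by omega) (by simp only; omega)
      · exact ProjectiveCheckerboard.diagonal_eq hm hn (by omega) (by simp only; omega)
  · rintro (⟨h1, h2, h3⟩ | ⟨h1, h2, h3, h4⟩)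
    · refine ProjectiveCheckerboard.exists_path_of_successor (p := p)
        (ProjectiveCheckerboard.NorthLower p y) ?_ (Or.inl (by simp only; omega)) hp2'
        (fun a b h => Or.inl h.1)
        (ProjectiveCheckerboard.reachesTerminal_northLower hpm hp2' (by simp only; omega) h3)
      refine ProjectiveCheckerboard.successor_injective hm hp1 ⟨rfl, rfl⟩ ?_ ?_ ?_ ?_
      · intro a b ha hb h; omega
      · intro a b ha hb h; simp only; omega
      · intro b d hbd h; simp only; omega
      · simp only; omega
    · refine ProjectiveCheckerboard.exists_path_of_successor (p := p)
        (ProjectiveCheckerboard.NorthUpper m n p y) ?_ (Or.inr (by simp only; omega)) hp2'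
        (fun a b h => by omega)
        (ProjectiveCheckerboard.reachesTerminal_northUpper hpm (by omega) hp2'
          (by simp only; omega) h2)
      refine ProjectiveCheckerboard.successor_injective hm hp1 ⟨rfl, rfl⟩ ?_ ?_ ?_ ?_
      · intro a b ha hb h; omega
      · intro a b ha hb h; simp only; omega
      · intro b d hbd h; simp only; omega
      · simp only; omega
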